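/- Scheduling model. Let $m\ge 1$ be a number of identical parallel machines. An instance is a finite list $I$ of jobs with integral processing times $p_j\ge 1$. A schedule assigns every job to one of the $m$ machines; its makespan is the maximum over the machines of the total processing time assigned to that machine, and $\mathrm{OPT}(I)$ is the minimum makespan of a schedule of $I$. In the online-list model the jobs are revealed one by one in the order of the list, and each job has to be assigned irrevocably to a machine before the next one is revealed. Thus a (deterministic) online algorithm $A$ for $m$ machines is an arbitrary map which, given the previously revealed jobs with their order and their assignment, and the processing time of the newly revealed job, chooses a machine for the new job; $A(I)$ denotes the makespan of the schedule it produces on $I$. The algorithm is $\rho$-competitive if $A(I)\le\rho\cdot\mathrm{OPT}(I)$ for every instance $I$, its competitive ratio $\rho_A(m)$ is the infimum of all $\rho$ such that $A$ is $\rho$-competitive, and the optimal competitive ratio for $m$ machines is $\rho^*(m)=\inf_A\rho_A(m)$, over all online algorithms $A$ for $m$ machines. Theorem. There is a competitive-ratio approximation scheme for the online-list variant of $Pm||C_{\max}$ for any number of machines $m$. That is, there is a single computable procedure which, given an integer $m\ge1$ and a rational $\varepsilon>0$ (as a fraction of positive integers), always halts and outputs 1. a program that computes (halting on every input) an online algorithm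 $A$ for $m$ machines with competitive ratio $\rho_A(m)\le(1+\varepsilon)\,\rho^*(m)$, and 2. a rational number $\rho'$ with $\rho'\le\rho^*(m)\le(1+\varepsilon)\,\rho'$. -/

import Mathlib

namespace OnlineList

/-- A (possibly partial) schedule on `m` identical machines: the jobs in the order of their
arrival, each given by its processing time and the machine it is assigned to. -/
abbrev Schedule (m : ℕ) : Type := List (ℕ × Fin m)

/-- Total processing time of the jobs on machine `i`, i.e. the completion time of that machine. -/
def load {m : ℕ} (S : Schedule m) (i : Fin m) : ℕ :=
  ((S.filter (fun j => j.2 = i)).map Prod.fst).sum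

/-- The makespan of a schedule: the last completion time over all machines. -/
def makespan {m : ℕ} (S : Schedule m) : ℕ :=
  Finset.univ.sup (load S)

/-- An instance: a finite list of processing times, integral and at least `1`, in the order of
arrival. -/
def IsInstance (I : List ℕ) : Prop := ∀ p ∈ I, 1 ≤ p

/-- The optimal offline makespan on `m` machines: the minimum of the makespan over all schedules
of the jobs in `I`. -/
noncomputable def opt (m : ℕ) (I : List ℕ) : ℕ :=
  sInf {x : ℕ | ∃ S : Schedule m, S.map Prod.fst = I ∧ makespan S = x}

/-- A configuration: the previously released jobs in their order together with their assignment
to the machines, and the processing time of the newly released, not yet assigned job. -/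
abbrev Configuration (m : ℕ) : Type := Schedule m × ℕ

/-- A (deterministic) online algorithm: in every configuration it chooses the machine of the newly
released job. No computability is required here. -/
abbrev OnlineAlgorithm (m : ℕ) : Type := Configuration m → Fin m

/-- The schedule that the online algorithm `f` produces on the instance `I`. -/
def run {m : ℕ} (f : OnlineAlgorithm m) (I : List ℕ) : Schedule m :=
  I.foldl (fun S p => S ++ [(p, f (S, p))]) []

/-- `f` is `ρ`-competitive: on every instance its makespan is at most `ρ` times the optimum. -/
def IsCompetitive {m : ℕ} (f : OnlineAlgorithm m) (ρ : ℝ) : Prop :=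
  ∀ I : List ℕ, IsInstance I → (makespan (run f I) : ℝ) ≤ ρ * (opt m I : ℝ)

/-- The competitive ratio of `f`: the infimum of all `ρ` such that `f` is `ρ`-competitive. -/
noncomputable def competitiveRatio {m : ℕ} (f : OnlineAlgorithm m) : ℝ :=
  sInf {ρ : ℝ | IsCompetitive f ρ}

/-- The optimal competitive ratio for `m` machines: the best competitive ratio that any online
algorithm achieves. -/
noncomputable def optimalRatio (m : ℕ) : ℝ :=
  ⨅ f : OnlineAlgorithm m, competitiveRatio f

/-- The program `c` computes the online algorithm `f`: it halts on (the code of) every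
configuration and returns the machine chosen by `f`. -/
def Computes {m : ℕ} (c : Nat.Partrec.Code) (f : OnlineAlgorithm m) : Prop :=
  ∀ C : Configuration m, c.eval (Encodable.encode C) = Part.some (f C : ℕ)

/-- `F` is a competitive-ratio approximation scheme for makespan minimization on identical parallel
machines in the online-list model. It is a single computable procedure; from the number `m` of
machines and an accuracy `ε = a / b` it computes a program for an online algorithm whose
competitive ratio is at most `(1 + ε)` times the optimal one, and a number `ρ' = p / q` that
estimates the optimal competitive ratio up to the factor `1 + ε`. -/
def IsApproximationScheme (F : ℕ × ℕ × ℕ → Nat.Partrec.Code × ℕ × ℕ) : Prop :=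
  Computable F ∧
    ∀ m a b : ℕ, 0 < m → 0 < a → 0 < b →
      ∀ (c : Nat.Partrec.Code) (p q : ℕ), F (m, a, b) = (c, p, q) →
        (∃ f : OnlineAlgorithm m, Computes c f ∧
          competitiveRatio f ≤ (1 + (a : ℝ) / b) * optimalRatio m) ∧
        0 < q ∧
        (p : ℝ) / q ≤ optimalRatio m ∧
        optimalRatio m ≤ (1 + (a : ℝ) / b) * ((p : ℝ) / q)

end OnlineList

namespace OnlineList

/-! ### Primitive recursive predicates with bounded quantifiers -/

section PrimrecAux

variable {α β : Type*} [Primcodable α] [Primcodable β]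

/-! Up to a factor close to 1, the game between online algorithm and adversary is a finite one. An
abstract state records, in a unit `u`, the online loads and the load vectors of the offline
schedules. A `Valid` table is a finite set of competitive states, closed under arrival of jobs of 1
to `R` units (while some offline schedule fits in `R`) and under doubling the unit.

A `k / g`-competitive algorithm yields such a table (`exists_valid`): take the rounded states of all
its runs. Conversely, a table for `k / g` yields an explicit algorithm of ratio `(k (n+1) + 1) / (n
g)` (`isCompetitive_tableAlgorithm`). It scales jobs by `Q`, rounds large jobs up to whole units,
and packs small jobs into chunks that the table treats as single jobs. The unit doubles as the
instance grows; additive errors are a constant number of units, and `Q` units are at most the scaled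
optimum, so these errors are negligible.

Whether a table exists for a given ratio is decided by bounded search. On the grid of step `1 / n`,
an index with a table at `(n + i + 1) / n` but none at `(n + i) / n` gives both an algorithm and a
lower bound on the optimal ratio (the trivial bound 1 if `i = 0`). For `n = 4 * b` the gap is at
most `1 + 1 / b`. -/

theorem PrimrecPred.forall_mem {f : α → List β} {p : α → β → Prop} (hf : Primrec f)
    (hp : PrimrecPred fun x : α × β => p x.1 x.2) : PrimrecPred fun a => ∀ b ∈ f a, p a b :=
  (PrimrecRel.forall_mem_list (R := fun b a => p a b)
    (hp.comp (Primrec.pair Primrec.snd Primrec.fst))).comp hf Primrec.id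

theorem PrimrecPred.exists_mem {f : α → List β} {p : α → β → Prop} (hf : Primrec f)
    (hp : PrimrecPred fun x : α × β => p x.1 x.2) : PrimrecPred fun a => ∃ b ∈ f a, p a b :=
  (PrimrecRel.exists_mem_list (R := fun b a => p a b)
    (hp.comp (Primrec.pair Primrec.snd Primrec.fst))).comp hf Primrec.id

theorem PrimrecPred.forall_bound {f : α → ℕ} {p : α → ℕ → Prop} (hf : Primrec f)
    (hp : PrimrecPred fun x : α × ℕ => p x.1 x.2) : PrimrecPred fun a => ∀ b < f a, p a b :=
  (PrimrecPred.forall_mem (Primrec.list_range.comp hf) hp).of_eq fun _ => by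
    simp only [List.mem_range]

theorem PrimrecPred.exists_bound {f : α → ℕ} {p : α → ℕ → Prop} (hf : Primrec f)
    (hp : PrimrecPred fun x : α × ℕ => p x.1 x.2) : PrimrecPred fun a => ∃ b < f a, p a b :=
  (PrimrecPred.exists_mem (Primrec.list_range.comp hf) hp).of_eq fun _ => by
    simp only [List.mem_range]

theorem PrimrecPred.imp {p q : α → Prop} (hp : PrimrecPred p) (hq : PrimrecPred q) :
    PrimrecPred fun a => p a → q a :=
  (hp.not.or hq).of_eq fun _ => imp_iff_not_or.symm

open Classical in
/-- The first element of `L` that satisfies `P`, if there is one. -/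
noncomputable def pick {γ : Type*} [Inhabited γ] (L : List γ) (P : γ → Prop) : γ :=
  (L.filter (fun a => decide (P a))).headI

theorem pick_spec {γ : Type*} [Inhabited γ] {L : List γ} {P : γ → Prop} (h : ∃ a ∈ L, P a) :
    pick L P ∈ L ∧ P (pick L P) := by
  classical
  have headI_mem : ∀ l : List γ, l ≠ [] → l.headI ∈ l := by
    rintro (_ | ⟨b, l⟩) hl
    · exact absurd rfl hl
    · exact List.mem_cons_self
  obtain ⟨a, ha, hp⟩ := h
  have := headI_mem (L.filter (fun a => decide (P a)))
    (List.ne_nil_of_mem (List.mem_filter.2 ⟨ha, decide_eq_true hp⟩))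
  rw [List.mem_filter, decide_eq_true_eq] at this
  exact this

theorem primrec_pick [Inhabited β] {f : α → List β} {p : α → β → Prop} (hf : Primrec f)
    (hp : PrimrecPred fun x : α × β => p x.1 x.2) : Primrec fun a => pick (f a) (p a) := by
  classical
  have h : Primrec₂ fun (L : List β) (a : α) => L.filter (fun b => decide (p a b)) :=
    PrimrecRel.listFilter (R := fun b a => p a b)
      (hp.comp (Primrec.pair Primrec.snd Primrec.fst))
  exact Primrec.list_headI.comp (h.comp hf Primrec.id)

/-- All sublists of a list. -/
def subs {γ : Type*} (L : List γ) : List (List γ) :=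
  L.foldr (fun a acc => acc ++ acc.map (List.cons a)) [[]]

/-- Lets an undecidable property cut out a candidate of the finite search: the table of an unknown
algorithm need not be computed, only be among the sublists. -/
theorem filter_mem_subs {γ : Type*} (P : γ → Bool) (L : List γ) : L.filter P ∈ subs L := by
  induction L with
  | nil => simp [subs]
  | cons a L ih =>
    have h : subs (a :: L) = subs L ++ (subs L).map (List.cons a) := rfl
    rw [h, List.mem_append]
    by_cases hp : P a
    · rw [List.filter_cons_of_pos hp]
      exact Or.inr (List.mem_map_of_mem ih)
    · rw [List.filter_cons_of_neg hp]
      exact Or.inl ih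

theorem primrec_subs {f : α → List β} (hf : Primrec f) : Primrec fun a => subs (f a) :=
  Primrec.list_foldr hf (Primrec.const [[]])
    (Primrec.list_append.comp (Primrec.snd.comp Primrec.snd)
      (Primrec.list_map (Primrec.snd.comp Primrec.snd)
        (Primrec.list_cons.comp (Primrec.fst.comp (Primrec.snd.comp Primrec.fst)) Primrec.snd).to₂)).to₂

/-- All lists of length `m` with entries at most `D`. -/
def vecs (D m : ℕ) : List (List ℕ) :=
  Nat.rec [[]] (fun _ acc => (List.range (D + 1)).flatMap fun a => acc.map (List.cons a)) m

theorem mem_vecs {D m : ℕ} {v : List ℕ} : v ∈ vecs D m ↔ v.length = m ∧ ∀ x ∈ v, x ≤ D := by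
  induction m generalizing v with
  | zero =>
    have h : vecs D 0 = [[]] := rfl
    rw [h, List.mem_singleton, List.length_eq_zero_iff]
    constructor
    · rintro rfl; simp
    · exact fun h => h.1
  | succ m ih =>
    have h : vecs D (m + 1) =
      (List.range (D + 1)).flatMap fun a => (vecs D m).map (List.cons a) := rfl
    rw [h]
    simp only [List.mem_flatMap, List.mem_range, List.mem_map, ih]
    constructor
    · rintro ⟨a, ha, w, ⟨hw, hb⟩, rfl⟩
      refine ⟨by simp [hw], ?_⟩
      intro x hx
      rcases List.mem_cons.1 hx with rfl | hx
      · omega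
      · exact hb x hx
    · rintro ⟨hl, hb⟩
      cases v with
      | nil => simp at hl
      | cons a w =>
        refine ⟨a, Nat.lt_succ_of_le (hb a (by simp)), w, ⟨by simpa using hl, ?_⟩, rfl⟩
        exact fun x hx => hb x (List.mem_cons_of_mem _ hx)

theorem primrec_vecs {D m : α → ℕ} (hD : Primrec D) (hm : Primrec m) :
    Primrec fun a => vecs (D a) (m a) :=
  Primrec.nat_rec' hm (Primrec.const [[]])
    (Primrec.list_flatMap (Primrec.list_range.comp (Primrec.succ.comp (hD.comp Primrec.fst)))
      (Primrec.list_map (Primrec.snd.comp (Primrec.snd.comp Primrec.fst))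
        (Primrec.list_cons.comp (Primrec.snd.comp Primrec.fst) Primrec.snd).to₂).to₂).to₂

end PrimrecAux

/-! ### Tables of abstract states -/

/-- An abstract state: the loads of the online schedule and a list of load vectors of offline
schedules, all measured in a common unit. -/
abbrev Entry : Type := List ℕ × List (List ℕ)

/-- The `j`-th coordinate of a vector. -/
def coord (v : List ℕ) (j : ℕ) : ℕ := v.getD j 0

/-- `e'` accounts for assigning a job of size `p` to machine `i` in the state `e`. -/
def JobStep (m : ℕ) (e : Entry) (p i : ℕ) (e' : Entry) : Prop :=
  (∀ j < m, coord e.1 j + (if j = i then p else 0) ≤ coord e'.1 j) ∧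
    ∀ o ∈ e.2, ∀ l < m, ∃ o' ∈ e'.2, ∀ j < m, coord o' j ≤ coord o j + if j = l then p else 0

/-- `e'` accounts for doubling the unit in the state `e`. -/
def HalfStep (m : ℕ) (e e' : Entry) : Prop :=
  (∀ j < m, coord e.1 j ≤ 2 * coord e'.1 j) ∧
    ∀ o ∈ e.2, ∃ o' ∈ e'.2, ∀ j < m, 2 * coord o' j ≤ coord o j + 1

/-- Some offline schedule recorded in `e` has makespan at most `R`. -/
def Small (m R : ℕ) (e : Entry) : Prop := ∃ o ∈ e.2, ∀ j < m, coord o j ≤ R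

/-- The state `e` is `k / g`-competitive up to one unit. -/
def Sound (m g k : ℕ) (e : Entry) : Prop :=
  ∀ o ∈ e.2, ∀ i < m, ∃ j < m, g * coord e.1 i ≤ k * coord o j + g

/-- `T` is a table of competitive states that is closed under the arrival of jobs of size at most
`R` and under doubling the unit. -/
def Valid (m R g k : ℕ) (T : List Entry) : Prop :=
  (∃ e ∈ T, Small m 0 e) ∧ ∀ e ∈ T, Sound m g k e ∧ Small m (2 * R) e ∧
    (∃ e' ∈ T, HalfStep m e e') ∧
      (Small m R e → ∀ p < R, ∃ i < m, ∃ e' ∈ T, JobStep m e (p + 1) i e')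

/-- All abstract states with coordinates at most `D`. -/
def entries (D m : ℕ) : List Entry :=
  (vecs D m).flatMap fun v => (subs (vecs D m)).map fun O => (v, O)

/-! ### Primitive recursiveness of table validity: every quantifier is bounded -/

section Computability

variable {α : Type*} [Primcodable α]

theorem primrec_coord {v : α → List ℕ} {j : α → ℕ} (hv : Primrec v) (hj : Primrec j) :
    Primrec fun a => coord (v a) (j a) :=
  (Primrec.list_getD 0).comp hv hj

theorem primrec_ite_eq {i j p : α → ℕ} (hi : Primrec i) (hj : Primrec j) (hp : Primrec p) :
    Primrec fun a => if i a = j a then p a else 0 :=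
  Primrec.ite (Primrec.eq.comp hi hj) hp (Primrec.const 0)

theorem primrecPred_jobStep {m p i : α → ℕ} {e e' : α → Entry} (hm : Primrec m) (he : Primrec e)
    (hp : Primrec p) (hi : Primrec i) (he' : Primrec e') :
    PrimrecPred fun a => JobStep (m a) (e a) (p a) (i a) (e' a) := by
  refine PrimrecPred.and (PrimrecPred.forall_bound hm ?_) (PrimrecPred.forall_mem
    (Primrec.snd.comp he) (PrimrecPred.forall_bound (hm.comp .fst) (PrimrecPred.exists_mem
      ((Primrec.snd.comp he').comp (Primrec.fst.comp .fst)) (PrimrecPred.forall_bound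
        (hm.comp (Primrec.fst.comp (Primrec.fst.comp .fst))) ?_))))
  · exact Primrec.nat_le.comp (Primrec.nat_add.comp
      (primrec_coord ((Primrec.fst.comp he).comp .fst) .snd)
      (primrec_ite_eq .snd (hi.comp .fst) (hp.comp .fst)))
      (primrec_coord ((Primrec.fst.comp he').comp .fst) .snd)
  · have h1 : Primrec fun x : (((α × List ℕ) × ℕ) × List ℕ) × ℕ => x.1.1 :=
      Primrec.fst.comp .fst
    exact Primrec.nat_le.comp (primrec_coord (Primrec.snd.comp .fst) .snd)
      (Primrec.nat_add.comp (primrec_coord (Primrec.snd.comp (Primrec.fst.comp h1)) .snd)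
        (primrec_ite_eq .snd (Primrec.snd.comp h1)
          (hp.comp (Primrec.fst.comp (Primrec.fst.comp h1)))))

theorem primrecPred_halfStep {m : α → ℕ} {e e' : α → Entry} (hm : Primrec m) (he : Primrec e)
    (he' : Primrec e') : PrimrecPred fun a => HalfStep (m a) (e a) (e' a) := by
  refine PrimrecPred.and (PrimrecPred.forall_bound hm ?_) (PrimrecPred.forall_mem
    (Primrec.snd.comp he) (PrimrecPred.exists_mem ((Primrec.snd.comp he').comp .fst)
      (PrimrecPred.forall_bound (hm.comp (Primrec.fst.comp .fst)) ?_)))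
  · exact Primrec.nat_le.comp (primrec_coord ((Primrec.fst.comp he).comp .fst) .snd)
      (Primrec.nat_double.comp (primrec_coord ((Primrec.fst.comp he').comp .fst) .snd))
  · exact Primrec.nat_le.comp
      (Primrec.nat_double.comp (primrec_coord (Primrec.snd.comp .fst) .snd))
      (Primrec.succ.comp (primrec_coord (Primrec.snd.comp (Primrec.fst.comp .fst)) .snd))

theorem primrecPred_small {m R : α → ℕ} {e : α → Entry} (hm : Primrec m) (hR : Primrec R)
    (he : Primrec e) : PrimrecPred fun a => Small (m a) (R a) (e a) := by
  refine PrimrecPred.exists_mem (Primrec.snd.comp he)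
    (PrimrecPred.forall_bound (hm.comp .fst) ?_)
  exact Primrec.nat_le.comp (primrec_coord (Primrec.snd.comp .fst) .snd)
    (hR.comp (Primrec.fst.comp .fst))

theorem primrecPred_sound {m g k : α → ℕ} {e : α → Entry} (hm : Primrec m) (hg : Primrec g)
    (hk : Primrec k) (he : Primrec e) : PrimrecPred fun a => Sound (m a) (g a) (k a) (e a) := by
  refine PrimrecPred.forall_mem (Primrec.snd.comp he) (PrimrecPred.forall_bound (hm.comp .fst)
    (PrimrecPred.exists_bound (hm.comp (Primrec.fst.comp .fst)) ?_))
  have h1 : Primrec fun x : ((α × List ℕ) × ℕ) × ℕ => x.1.1 := Primrec.fst.comp .fst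
  have h2 : Primrec fun x : ((α × List ℕ) × ℕ) × ℕ => x.1.1.1 := Primrec.fst.comp h1
  exact Primrec.nat_le.comp
    (Primrec.nat_mul.comp (hg.comp h2)
      (primrec_coord (Primrec.fst.comp (he.comp h2)) (Primrec.snd.comp .fst)))
    (Primrec.nat_add.comp
      (Primrec.nat_mul.comp (hk.comp h2) (primrec_coord (Primrec.snd.comp h1) .snd))
      (hg.comp h2))

theorem primrecPred_valid {m R g k : α → ℕ} {T : α → List Entry} (hm : Primrec m)
    (hR : Primrec R) (hg : Primrec g) (hk : Primrec k) (hT : Primrec T) :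
    PrimrecPred fun a => Valid (m a) (R a) (g a) (k a) (T a) := by
  refine PrimrecPred.and
    (PrimrecPred.exists_mem hT (primrecPred_small (hm.comp .fst) (Primrec.const 0) .snd))
    (PrimrecPred.forall_mem hT (PrimrecPred.and ?_ (PrimrecPred.and ?_ (PrimrecPred.and ?_ ?_))))
  · exact primrecPred_sound (hm.comp .fst) (hg.comp .fst) (hk.comp .fst) .snd
  · exact primrecPred_small (hm.comp .fst) (Primrec.nat_double.comp (hR.comp .fst)) .snd
  · exact PrimrecPred.exists_mem (hT.comp .fst)
      (primrecPred_halfStep (hm.comp (Primrec.fst.comp .fst)) (Primrec.snd.comp .fst) .snd)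
  · refine PrimrecPred.imp (primrecPred_small (hm.comp .fst) (hR.comp .fst) .snd)
      (PrimrecPred.forall_bound (hR.comp .fst) (PrimrecPred.exists_bound
        (hm.comp (Primrec.fst.comp .fst)) (PrimrecPred.exists_mem
          (hT.comp (Primrec.fst.comp (Primrec.fst.comp .fst))) ?_)))
    have h1 : Primrec fun x : (((α × Entry) × ℕ) × ℕ) × Entry => x.1.1 := Primrec.fst.comp .fst
    exact primrecPred_jobStep (hm.comp (Primrec.fst.comp (Primrec.fst.comp h1)))
      (Primrec.snd.comp (Primrec.fst.comp h1)) (Primrec.succ.comp (Primrec.snd.comp h1))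
      (Primrec.snd.comp .fst) .snd

theorem primrec_entries {D m : α → ℕ} (hD : Primrec D) (hm : Primrec m) :
    Primrec fun a => entries (D a) (m a) :=
  Primrec.list_flatMap (primrec_vecs hD hm)
    (Primrec.list_map ((primrec_subs (primrec_vecs hD hm)).comp .fst)
      (Primrec.pair (Primrec.snd.comp .fst) .snd).to₂).to₂

end Computability

/-! ### The online algorithm given by a table -/

/-- The state of the algorithm: the unit, the free room in the open chunk of small jobs, the machine
of that chunk, and the abstract state. -/
abbrev State : Type := ℕ × ℕ × ℕ × Entry

/-- Double the unit. -/
noncomputable def doubleUnit (m : ℕ) (T : List Entry) (s : State) : State :=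
  (2 * s.1, 0, 0, pick T (HalfStep m s.2.2.2))

open Classical in
/-- Double the unit unless the state and the job size `x` are small compared to it. -/
noncomputable def adjust (m R : ℕ) (T : List Entry) (x : ℕ) (s : State) : State :=
  if Small m R s.2.2.2 ∧ x ≤ R * s.1 then s else doubleUnit m T s

/-- Double the unit until the state and the job size `x` are small compared to it. -/
noncomputable def prepare (m R : ℕ) (T : List Entry) (x : ℕ) (s : State) : State :=
  (adjust m R T x)^[x] s

/-- The machine and the new abstract state for an abstract job of size `p`. -/
noncomputable def pickJob (m : ℕ) (T : List Entry) (e : Entry) (p : ℕ) : ℕ × Entry :=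
  pick ((List.range m).flatMap fun i => T.map (Prod.mk i)) fun q => JobStep m e p q.1 q.2

/-- Place a job of size `x`: a large job becomes an abstract job, the small jobs are collected in
chunks. The result is the new state and the machine of the job. -/
noncomputable def place (m n : ℕ) (T : List Entry) (x : ℕ) (s : State) : State × ℕ :=
  if n * s.1 ≤ x then
    ((s.1, s.2.1, s.2.2.1, (pickJob m T s.2.2.2 ((x + s.1 - 1) / s.1)).2),
      (pickJob m T s.2.2.2 ((x + s.1 - 1) / s.1)).1)
  else if x ≤ s.2.1 then ((s.1, s.2.1 - x, s.2.2.1, s.2.2.2), s.2.2.1)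
  else
    ((s.1, (n * n + n) * s.1 - x, (pickJob m T s.2.2.2 (n * n + n)).1,
      (pickJob m T s.2.2.2 (n * n + n)).2), (pickJob m T s.2.2.2 (n * n + n)).1)

/-- Process a job of size `x`. -/
noncomputable def process (m n R : ℕ) (T : List Entry) (s : State) (x : ℕ) : State × ℕ :=
  place m n T x (prepare m R T x s)

/-- The state after the jobs `I`, scaled by `Q`. -/
noncomputable def stateAfter (m n Q R : ℕ) (T : List Entry) (I : List ℕ) : State :=
  I.foldl (fun s x => (process m n R T s (Q * x)).1) (1, 0, 0, pick T (Small m 0))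

/-- The machine chosen for the job `p` after the jobs `I`. -/
noncomputable def chosenMachine (m n Q R : ℕ) (T : List Entry) (I : List ℕ) (p : ℕ) : ℕ :=
  (process m n R T (stateAfter m n Q R T I) (Q * p)).2 % m

/-! ### Primitive recursiveness of the table algorithm -/

section Computability

variable {α : Type*} [Primcodable α]

theorem primrec_doubleUnit {m : α → ℕ} {T : α → List Entry} {s : α → State} (hm : Primrec m)
    (hT : Primrec T) (hs : Primrec s) : Primrec fun a => doubleUnit (m a) (T a) (s a) :=
  Primrec.pair (Primrec.nat_double.comp (Primrec.fst.comp hs))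
    (Primrec.pair (Primrec.const 0) (Primrec.pair (Primrec.const 0)
      (primrec_pick hT (primrecPred_halfStep (hm.comp .fst)
        (Primrec.snd.comp (Primrec.snd.comp (Primrec.snd.comp (hs.comp .fst)))) .snd))))

theorem primrec_prepare {m R x : α → ℕ} {T : α → List Entry} {s : α → State} (hm : Primrec m)
    (hR : Primrec R) (hT : Primrec T) (hx : Primrec x) (hs : Primrec s) :
    Primrec fun a => prepare (m a) (R a) (T a) (x a) (s a) := by
  classical
  have h : Primrec fun q : α × State => adjust (m q.1) (R q.1) (T q.1) (x q.1) q.2 := by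
    refine Primrec.ite (PrimrecPred.and ?_ ?_) Primrec.snd ?_
    · exact primrecPred_small (hm.comp .fst) (hR.comp .fst)
        (Primrec.snd.comp (Primrec.snd.comp (Primrec.snd.comp .snd)))
    · exact Primrec.nat_le.comp (hx.comp .fst)
        (Primrec.nat_mul.comp (hR.comp .fst) (Primrec.fst.comp .snd))
    · exact primrec_doubleUnit (hm.comp .fst) (hT.comp .fst) .snd
  exact Primrec.nat_iterate hx hs h.to₂

theorem primrec_pickJob {m p : α → ℕ} {T : α → List Entry} {e : α → Entry} (hm : Primrec m)
    (hT : Primrec T) (he : Primrec e) (hp : Primrec p) :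
    Primrec fun a => pickJob (m a) (T a) (e a) (p a) :=
  primrec_pick (Primrec.list_flatMap (Primrec.list_range.comp hm)
      (Primrec.list_map (hT.comp .fst) (Primrec.pair (Primrec.snd.comp .fst) .snd).to₂).to₂)
    (primrecPred_jobStep (hm.comp .fst) (he.comp .fst) (hp.comp .fst)
      (Primrec.fst.comp .snd) (Primrec.snd.comp .snd))

theorem primrec_place {m n x : α → ℕ} {T : α → List Entry} {s : α → State} (hm : Primrec m)
    (hn : Primrec n) (hT : Primrec T) (hx : Primrec x) (hs : Primrec s) :
    Primrec fun a => place (m a) (n a) (T a) (x a) (s a) := by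
  have hu : Primrec fun a => (s a).1 := Primrec.fst.comp hs
  have h2 : Primrec fun a => (s a).2 := Primrec.snd.comp hs
  have hv : Primrec fun a => (s a).2.1 := Primrec.fst.comp h2
  have h3 : Primrec fun a => (s a).2.2 := Primrec.snd.comp h2
  have hc : Primrec fun a => (s a).2.2.1 := Primrec.fst.comp h3
  have he : Primrec fun a => (s a).2.2.2 := Primrec.snd.comp h3
  have hB : Primrec fun a => n a * n a + n a :=
    Primrec.nat_add.comp (Primrec.nat_mul.comp hn hn) hn
  have hj := primrec_pickJob hm hT he (Primrec.nat_div.comp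
    (Primrec.nat_sub.comp (Primrec.nat_add.comp hx hu) (Primrec.const 1)) hu)
  have hk := primrec_pickJob hm hT he hB
  refine Primrec.ite (Primrec.nat_le.comp (Primrec.nat_mul.comp hn hu) hx) ?_
    (Primrec.ite (Primrec.nat_le.comp hx hv) ?_ ?_)
  · exact Primrec.pair (Primrec.pair hu (Primrec.pair hv (Primrec.pair hc (Primrec.snd.comp hj))))
      (Primrec.fst.comp hj)
  · exact Primrec.pair (Primrec.pair hu (Primrec.pair (Primrec.nat_sub.comp hv hx)
      (Primrec.pair hc he))) hc
  · exact Primrec.pair (Primrec.pair hu (Primrec.pair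
      (Primrec.nat_sub.comp (Primrec.nat_mul.comp hB hu) hx)
        (Primrec.pair (Primrec.fst.comp hk) (Primrec.snd.comp hk)))) (Primrec.fst.comp hk)

theorem primrec_process {m n R x : α → ℕ} {T : α → List Entry} {s : α → State} (hm : Primrec m)
    (hn : Primrec n) (hR : Primrec R) (hT : Primrec T) (hs : Primrec s) (hx : Primrec x) :
    Primrec fun a => process (m a) (n a) (R a) (T a) (s a) (x a) :=
  primrec_place hm hn hT hx (primrec_prepare hm hR hT hx hs)

theorem primrec_chosenMachine {m n Q R p : α → ℕ} {T : α → List Entry} {I : α → List ℕ}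
    (hm : Primrec m) (hn : Primrec n) (hQ : Primrec Q) (hR : Primrec R) (hT : Primrec T)
    (hI : Primrec I) (hp : Primrec p) :
    Primrec fun a => chosenMachine (m a) (n a) (Q a) (R a) (T a) (I a) (p a) := by
  refine Primrec.nat_mod.comp (Primrec.snd.comp (primrec_process hm hn hR hT ?_
    (Primrec.nat_mul.comp hQ hp))) hm
  refine Primrec.list_foldl hI (Primrec.pair (Primrec.const 1) (Primrec.pair (Primrec.const 0)
    (Primrec.pair (Primrec.const 0) (primrec_pick hT
      (primrecPred_small (hm.comp .fst) (Primrec.const 0) .snd)))))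
    (Primrec.fst.comp (primrec_process (hm.comp .fst) (hn.comp .fst) (hR.comp .fst) (hT.comp .fst)
      (Primrec.fst.comp .snd) (Primrec.nat_mul.comp (hQ.comp .fst) (Primrec.snd.comp .snd)))).to₂

end Computability

/-! ### Schedules -/

variable {m : ℕ}

theorem load_nil (i : Fin m) : load ([] : Schedule m) i = 0 := rfl

theorem load_concat (S : Schedule m) (p : ℕ) (i j : Fin m) :
    load (S ++ [(p, i)]) j = load S j + if j = i then p else 0 := by
  by_cases h : j = i
  · simp [load, h]
  · simp [load, h, Ne.symm h]

theorem sum_load (S : Schedule m) : ∑ i, load S i = (S.map Prod.fst).sum := by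
  induction S using List.reverseRecOn with
  | nil => simp [load]
  | append_singleton S a ih =>
    obtain ⟨p, i⟩ := a
    simp [load_concat, Finset.sum_add_distrib, ih]

theorem run_concat (f : OnlineAlgorithm m) (I : List ℕ) (p : ℕ) :
    run f (I ++ [p]) = run f I ++ [(p, f (run f I, p))] := by
  simp [run]

theorem run_map_fst (f : OnlineAlgorithm m) (I : List ℕ) : (run f I).map Prod.fst = I := by
  induction I using List.reverseRecOn with
  | nil => rfl
  | append_singleton I p ih => simp [run_concat, ih]

theorem load_le_makespan (S : Schedule m) (i : Fin m) : load S i ≤ makespan S :=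
  Finset.le_sup (f := load S) (Finset.mem_univ i)

theorem opt_le_makespan (S : Schedule m) : opt m (S.map Prod.fst) ≤ makespan S :=
  Nat.sInf_le ⟨S, rfl, rfl⟩

theorem exists_makespan_eq_opt (hm : 0 < m) (I : List ℕ) :
    ∃ S : Schedule m, S.map Prod.fst = I ∧ makespan S = opt m I :=
  Nat.sInf_mem (s := {x : ℕ | ∃ S : Schedule m, S.map Prod.fst = I ∧ makespan S = x})
    ⟨_, run (fun _ => ⟨0, hm⟩) I, run_map_fst _ _, rfl⟩

/-- Every schedule of the jobs `I ++ [p]` extends a schedule of the jobs `I`. -/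
theorem exists_eq_concat {S : Schedule m} {I : List ℕ} {p : ℕ} (h : S.map Prod.fst = I ++ [p]) :
    ∃ (S' : Schedule m) (i : Fin m), S'.map Prod.fst = I ∧ S = S' ++ [(p, i)] := by
  obtain ⟨S₁, S₂, rfl, h₁, h₂⟩ := List.map_eq_append_iff.1 h
  obtain ⟨⟨q, i⟩, rfl, rfl⟩ := List.map_eq_singleton_iff.1 h₂
  exact ⟨S₁, i, h₁, rfl⟩

/-! ### Competitive ratios -/

theorem IsCompetitive.mono {f : OnlineAlgorithm m} {ρ σ : ℝ} (h : IsCompetitive f ρ)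
    (hρ : ρ ≤ σ) : IsCompetitive f σ := fun I hI =>
  (h I hI).trans (mul_le_mul_of_nonneg_right hρ (Nat.cast_nonneg _))

/-- The total work bounds any makespan from above and is at most `m` times the optimum. Keeps the
infima over nonempty sets and bounds the search for the ratio. -/
theorem isCompetitive_machines (hm : 0 < m) (f : OnlineAlgorithm m) : IsCompetitive f m := by
  intro I _
  obtain ⟨S, hS, hS'⟩ := exists_makespan_eq_opt hm I
  have h1 : makespan (run f I) ≤ I.sum := by
    refine Finset.sup_le fun i _ => ?_
    have := Finset.single_le_sum (f := load (run f I)) (fun _ _ => Nat.zero_le _)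
      (Finset.mem_univ i)
    rwa [sum_load, run_map_fst] at this
  have h2 : I.sum ≤ m * opt m I := by
    rw [← hS', ← hS, ← sum_load]
    calc ∑ i, load S i ≤ ∑ _i : Fin m, makespan S :=
          Finset.sum_le_sum fun i _ => load_le_makespan S i
      _ = m * makespan S := by simp
  exact_mod_cast h1.trans h2

theorem one_le_of_isCompetitive {f : OnlineAlgorithm m} {ρ : ℝ} (h : IsCompetitive f ρ) :
    1 ≤ ρ := by
  have h1 := h [1] (by simp [IsInstance])
  have h2 : ∀ i : Fin m, 1 ≤ makespan ([(1, i)] : Schedule m) := fun i => by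
    simpa [load] using load_le_makespan ([(1, i)] : Schedule m) i
  have h3 : opt m [1] = 1 := by
    let i := f ([], 1)
    apply le_antisymm
    · refine (opt_le_makespan ([(1, i)] : Schedule m)).trans (Finset.sup_le fun j _ => ?_)
      have := load_concat ([] : Schedule m) 1 i j
      rw [load_nil, List.nil_append] at this
      rw [this]; split_ifs <;> simp
    · obtain ⟨S, hS, hS'⟩ := exists_makespan_eq_opt i.pos [1]
      obtain ⟨⟨q, j⟩, rfl, rfl⟩ := List.map_eq_singleton_iff.1 hS
      rw [← hS']; exact h2 j
  rw [h3] at h1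
  have h4 : (1 : ℝ) ≤ makespan (run f [1]) := by exact_mod_cast h2 _
  simpa using h4.trans h1

theorem competitiveRatio_le {f : OnlineAlgorithm m} {ρ : ℝ} (h : IsCompetitive f ρ) :
    competitiveRatio f ≤ ρ :=
  csInf_le ⟨1, fun _ h => one_le_of_isCompetitive h⟩ h

theorem one_le_competitiveRatio (hm : 0 < m) (f : OnlineAlgorithm m) : 1 ≤ competitiveRatio f :=
  le_csInf ⟨m, isCompetitive_machines hm f⟩ fun _ h => one_le_of_isCompetitive h

theorem optimalRatio_le (hm : 0 < m) (f : OnlineAlgorithm m) :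
    optimalRatio m ≤ competitiveRatio f :=
  ciInf_le ⟨1, by rintro _ ⟨g, rfl⟩; exact one_le_competitiveRatio hm g⟩ f

theorem one_le_optimalRatio (hm : 0 < m) : 1 ≤ optimalRatio m :=
  have : Nonempty (OnlineAlgorithm m) := ⟨fun _ => ⟨0, hm⟩⟩
  le_ciInf (one_le_competitiveRatio hm)

theorem exists_isCompetitive_of_optimalRatio_lt (hm : 0 < m) {ρ : ℝ} (h : optimalRatio m < ρ) :
    ∃ f : OnlineAlgorithm m, IsCompetitive f ρ := by
  have : Nonempty (OnlineAlgorithm m) := ⟨fun _ => ⟨0, hm⟩⟩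
  obtain ⟨f, hf⟩ := exists_lt_of_ciInf_lt h
  obtain ⟨σ, hσ, hlt⟩ := exists_lt_of_csInf_lt ⟨(m : ℝ), isCompetitive_machines hm f⟩ hf
  exact ⟨f, IsCompetitive.mono hσ hlt.le⟩

/-! ### A competitive algorithm yields a valid table -/

section Table

variable {m : ℕ}

/-- Rounding up commutes with adding whole units, so job steps in the table cause no rounding error.
-/
theorem ceilDiv_add_mul {u : ℕ} (hu : 0 < u) (x p : ℕ) :
    (x + p * u) ⌈/⌉ u = x ⌈/⌉ u + p := by
  rw [Nat.ceilDiv_eq_add_pred_div, Nat.ceilDiv_eq_add_pred_div,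
    show x + p * u + u - 1 = x + u - 1 + p * u by omega, Nat.add_mul_div_right _ _ hu]

/-- The loads of a schedule in the unit `u`, rounded up. -/
def loadVec (u : ℕ) (S : Schedule m) : List ℕ := List.ofFn fun i => load S i ⌈/⌉ u

theorem coord_loadVec (u : ℕ) (S : Schedule m) (i : Fin m) :
    coord (loadVec u S) i = load S i ⌈/⌉ u := by
  simp [coord, loadVec]

open Classical in
/-- The abstract state of the schedule `S`, in the unit `u`. -/
noncomputable def entryOf (D u : ℕ) (S : Schedule m) : Entry :=
  (loadVec u S, (vecs D m).filter fun v =>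
    ∃ S' : Schedule m, S'.map Prod.fst = S.map Prod.fst ∧ v = loadVec u S')

/-- The jobs `I` have a schedule of makespan at most `2 * R` units. -/
def Fits (m R u : ℕ) (I : List ℕ) : Prop :=
  ∃ S : Schedule m, S.map Prod.fst = I ∧ ∀ i, load S i ≤ u * (2 * R)

/-- One schedule within `2 * R` units bounds the total work by `m * (2 * R)` units, hence every load
of every schedule of the same jobs. So `entryOf` truncates nothing. -/
theorem Fits.loadVec_mem {R u : ℕ} {S : Schedule m} (hu : 0 < u)
    (h : Fits m R u (S.map Prod.fst)) : loadVec u S ∈ vecs (m * (2 * R)) m := by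
  obtain ⟨S', hS', hl⟩ := h
  refine mem_vecs.2 ⟨by simp [loadVec], fun x hx => ?_⟩
  obtain ⟨i, rfl⟩ := (List.mem_ofFn' _ _).1 hx
  rw [ceilDiv_le_iff_le_mul hu]
  calc load S i ≤ ∑ j, load S j :=
        Finset.single_le_sum (f := load S) (fun _ _ => Nat.zero_le _) (Finset.mem_univ i)
    _ = ∑ j, load S' j := by rw [sum_load, sum_load, hS']
    _ ≤ ∑ _j : Fin m, u * (2 * R) := Finset.sum_le_sum fun j _ => hl j
    _ = u * (m * (2 * R)) := by simp; ring

theorem mem_entryOf {R u : ℕ} {S : Schedule m} (hu : 0 < u) (h : Fits m R u (S.map Prod.fst))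
    {v : List ℕ} : v ∈ (entryOf (m * (2 * R)) u S).2 ↔
      ∃ S' : Schedule m, S'.map Prod.fst = S.map Prod.fst ∧ v = loadVec u S' := by
  unfold entryOf
  simp only [List.mem_filter, decide_eq_true_eq, and_iff_right_iff_imp]
  rintro ⟨S', hS', rfl⟩
  exact Fits.loadVec_mem hu (hS' ▸ h)

/-- Rounding up raises an online load by less than one unit, the slack `g` in `Sound`; on the
offline side it only helps. The machine `j` is one attaining the offline makespan. -/
theorem sound_entryOf {R u g k : ℕ} {S : Schedule m} (hm : 0 < m) (hu : 0 < u)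
    (h : Fits m R u (S.map Prod.fst)) (hc : g * makespan S ≤ k * opt m (S.map Prod.fst)) :
    Sound m g k (entryOf (m * (2 * R)) u S) := by
  intro o ho i hi
  obtain ⟨S', hS', rfl⟩ := (mem_entryOf hu h).1 ho
  have : Nonempty (Fin m) := ⟨⟨0, hm⟩⟩
  obtain ⟨j, -, hj⟩ := Finset.exists_mem_eq_sup Finset.univ Finset.univ_nonempty (load S')
  refine ⟨j, j.2, ?_⟩
  have h1 := coord_loadVec u S ⟨i, hi⟩
  have h2 : g * load S ⟨i, hi⟩ ≤ k * load S' j := by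
    calc g * load S ⟨i, hi⟩ ≤ g * makespan S := Nat.mul_le_mul_left _ (load_le_makespan S _)
      _ ≤ k * opt m (S'.map Prod.fst) := by rw [hS']; exact hc
      _ ≤ k * makespan S' := Nat.mul_le_mul_left _ (opt_le_makespan S')
      _ = k * load S' j := by rw [← hj]; rfl
  change g * coord (loadVec u S) i ≤ _
  rw [h1, coord_loadVec]
  have h3 : load S' j ≤ u * (load S' j ⌈/⌉ u) := (ceilDiv_le_iff_le_mul hu).1 le_rfl
  rcases Nat.eq_zero_or_pos (load S ⟨i, hi⟩ ⌈/⌉ u) with h0 | h0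
  · rw [h0]; simp
  · have h4 : ¬ load S ⟨i, hi⟩ ≤ u * (load S ⟨i, hi⟩ ⌈/⌉ u - 1) := by
      rw [← ceilDiv_le_iff_le_mul hu]; omega
    obtain ⟨c, hc'⟩ : ∃ c, load S ⟨i, hi⟩ ⌈/⌉ u = c + 1 := ⟨_, (Nat.succ_pred_eq_of_pos h0).symm⟩
    rw [hc'] at h4 ⊢
    rw [Nat.add_sub_cancel, not_le] at h4
    have h5 : u * (g * c) ≤ u * (k * (load S' j ⌈/⌉ u)) := by
      calc u * (g * c) = g * (u * c) := by ring
        _ ≤ g * load S ⟨i, hi⟩ := Nat.mul_le_mul_left _ h4.le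
        _ ≤ k * (u * (load S' j ⌈/⌉ u)) := h2.trans (Nat.mul_le_mul_left _ h3)
        _ = _ := by ring
    have h6 := Nat.le_of_mul_le_mul_left h5 hu
    rw [mul_add, mul_one]
    omega

theorem small_entryOf {R u r : ℕ} {S : Schedule m} (hu : 0 < u)
    (h : Fits m R u (S.map Prod.fst)) : Small m r (entryOf (m * (2 * R)) u S) ↔
      ∃ S' : Schedule m, S'.map Prod.fst = S.map Prod.fst ∧ ∀ i, load S' i ≤ u * r := by
  constructor
  · rintro ⟨o, ho, hs⟩
    obtain ⟨S', hS', rfl⟩ := (mem_entryOf hu h).1 ho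
    refine ⟨S', hS', fun i => ?_⟩
    have := hs i i.2
    rwa [coord_loadVec, ceilDiv_le_iff_le_mul hu] at this
  · rintro ⟨S', hS', hl⟩
    refine ⟨_, (mem_entryOf hu h).2 ⟨S', hS', rfl⟩, fun j hj => ?_⟩
    have := coord_loadVec u S' ⟨j, hj⟩
    rw [this, ceilDiv_le_iff_le_mul hu]
    exact hl _

theorem halfStep_entryOf {R u : ℕ} {S : Schedule m} (hu : 0 < u)
    (h : Fits m R u (S.map Prod.fst)) (h' : Fits m R (2 * u) (S.map Prod.fst)) :
    HalfStep m (entryOf (m * (2 * R)) u S) (entryOf (m * (2 * R)) (2 * u) S) := by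
  have hu2 : 0 < 2 * u := by omega
  constructor
  · intro j hj
    have h1 := coord_loadVec u S ⟨j, hj⟩
    have h2 := coord_loadVec (2 * u) S ⟨j, hj⟩
    change coord (loadVec u S) j ≤ 2 * coord (loadVec (2 * u) S) j
    rw [h1, h2, ceilDiv_le_iff_le_mul hu]
    have := (ceilDiv_le_iff_le_mul (c := load S ⟨j, hj⟩ ⌈/⌉ (2 * u)) hu2).1 le_rfl
    linarith
  · intro o ho
    obtain ⟨S', hS', rfl⟩ := (mem_entryOf hu h).1 ho
    refine ⟨_, (mem_entryOf hu2 h').2 ⟨S', hS', rfl⟩, fun j hj => ?_⟩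
    have h1 := coord_loadVec u S' ⟨j, hj⟩
    have h2 := coord_loadVec (2 * u) S' ⟨j, hj⟩
    rw [h1, h2]
    have h3 : load S' ⟨j, hj⟩ ≤ u * (load S' ⟨j, hj⟩ ⌈/⌉ u) := (ceilDiv_le_iff_le_mul hu).1 le_rfl
    have h4 : load S' ⟨j, hj⟩ ⌈/⌉ (2 * u) ≤ (load S' ⟨j, hj⟩ ⌈/⌉ u + 1) / 2 := by
      rw [ceilDiv_le_iff_le_mul hu2]
      refine h3.trans ?_
      rw [mul_comm 2 u, mul_assoc]
      exact Nat.mul_le_mul_left _ (by omega)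
    omega

theorem jobStep_entryOf {R u p : ℕ} {S : Schedule m} (hu : 0 < u) (i : Fin m)
    (h : Fits m R u (S.map Prod.fst)) (h' : Fits m R u ((S ++ [(p * u, i)]).map Prod.fst)) :
    JobStep m (entryOf (m * (2 * R)) u S) p i (entryOf (m * (2 * R)) u (S ++ [(p * u, i)])) := by
  have key : ∀ (S : Schedule m) (i : Fin m) (l j : ℕ), l = i → j < m →
      coord (loadVec u (S ++ [(p * u, i)])) j =
        coord (loadVec u S) j + if j = l then p else 0 := by
    rintro S i l j rfl hj
    have h1 := coord_loadVec u S ⟨j, hj⟩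
    have h2 := coord_loadVec u (S ++ [(p * u, i)]) ⟨j, hj⟩
    rw [h1, h2, load_concat]
    simp only [Fin.ext_iff]
    split_ifs
    · exact ceilDiv_add_mul hu _ _
    · simp
  refine ⟨fun j hj => ?_, fun o ho l hl => ?_⟩
  · change _ ≤ coord (loadVec u (S ++ [(p * u, i)])) j
    rw [key S i i j rfl hj]
    rfl
  · obtain ⟨S', hS', rfl⟩ := (mem_entryOf hu h).1 ho
    refine ⟨loadVec u (S' ++ [(p * u, ⟨l, hl⟩)]), ?_, fun j hj => ?_⟩
    · rw [mem_entryOf hu h']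
      exact ⟨_, by simp only [List.map_append, hS', List.map_cons], rfl⟩
    · exact (key S' ⟨l, hl⟩ l j rfl hj).le

/-- The table consists of the states of all runs of `f`, in all units `2 ^ t` in which the instance
fits. Closure under jobs comes from letting `f` continue with a job of `p + 1` units; closure under
doubling from reading the same run in the unit `2 ^ (t + 1)`. -/
theorem exists_valid {f : OnlineAlgorithm m} {g k : ℕ} (hm : 0 < m) (hg : 0 < g)
    (hf : IsCompetitive f ((k : ℝ) / g)) (R : ℕ) :
    ∃ T ∈ subs (entries (m * (2 * R)) m), Valid m R g k T := by
  classical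
  let P : Entry → Prop := fun e => ∃ (I : List ℕ) (t : ℕ), IsInstance I ∧ Fits m R (2 ^ t) I ∧
    e = entryOf (m * (2 * R)) (2 ^ t) (run f I)
  have hpow : ∀ t : ℕ, 0 < 2 ^ t := fun t => by positivity
  have hmem : ∀ (I : List ℕ) (t : ℕ), IsInstance I → Fits m R (2 ^ t) I →
      entryOf (m * (2 * R)) (2 ^ t) (run f I) ∈
        (entries (m * (2 * R)) m).filter fun e => decide (P e) := by
    intro I t hI hF
    refine List.mem_filter.2 ⟨List.mem_flatMap.2 ⟨_, ?_, List.mem_map.2 ⟨_, ?_, rfl⟩⟩,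
      decide_eq_true ⟨I, t, hI, hF, rfl⟩⟩
    · exact Fits.loadVec_mem (hpow t) ((run_map_fst f I).symm ▸ hF)
    · exact filter_mem_subs _ _
  refine ⟨(entries (m * (2 * R)) m).filter fun e => decide (P e), filter_mem_subs _ _, ?_, ?_⟩
  · have hF : Fits m R (2 ^ 0) [] := ⟨[], rfl, fun i => by simp [load]⟩
    refine ⟨_, hmem [] 0 (by simp [IsInstance]) hF, ?_⟩
    exact (small_entryOf (S := run f []) (hpow 0) hF).2 ⟨[], rfl, fun i => by simp [load]⟩
  · intro e he
    obtain ⟨I, t, hI, hF, rfl⟩ := of_decide_eq_true (List.mem_filter.1 he).2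
    have hF' : Fits m R (2 ^ t) ((run f I).map Prod.fst) := (run_map_fst f I).symm ▸ hF
    refine ⟨sound_entryOf hm (hpow t) hF' ?_, (small_entryOf (hpow t) hF').2 hF', ?_, ?_⟩
    · have h1 := hf I hI
      rw [run_map_fst]
      rw [div_mul_eq_mul_div, le_div_iff₀ (by exact_mod_cast hg), mul_comm] at h1
      exact_mod_cast h1
    · obtain ⟨S, hS, hl⟩ := hF
      have hF2 : Fits m R (2 ^ (t + 1)) I :=
        ⟨S, hS, fun i => (hl i).trans
          (Nat.mul_le_mul_right _ (Nat.pow_le_pow_right (by omega) (Nat.le_succ t)))⟩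
      refine ⟨_, hmem I (t + 1) hI hF2, ?_⟩
      rw [pow_succ'] at hF2 ⊢
      exact halfStep_entryOf (hpow t) hF' ((run_map_fst f I).symm ▸ hF2)
    · intro hs p hp
      obtain ⟨S, hS, hl⟩ := (small_entryOf (hpow t) hF').1 hs
      rw [run_map_fst] at hS
      let i := f (run f I, (p + 1) * 2 ^ t)
      have hF2 : Fits m R (2 ^ t) (I ++ [(p + 1) * 2 ^ t]) := by
        refine ⟨S ++ [((p + 1) * 2 ^ t, i)], by simp [hS], fun j => ?_⟩
        rw [load_concat]
        have h1 := hl j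
        have h2 : (p + 1) * 2 ^ t ≤ 2 ^ t * R := by
          rw [mul_comm]; exact Nat.mul_le_mul_left _ hp
        split_ifs <;> nlinarith
      refine ⟨i, i.2, _, hmem (I ++ [(p + 1) * 2 ^ t]) t ?_ hF2, ?_⟩
      · intro q hq
        rcases List.mem_append.1 hq with hq | hq
        · exact hI q hq
        · rw [List.mem_singleton.1 hq]
          exact Nat.mul_pos (Nat.succ_pos p) (hpow t)
      · rw [run_concat]
        refine jobStep_entryOf (hpow t) i hF' ?_
        rw [← run_concat, run_map_fst]
        exact hF2

end Table

/-! ### The algorithm given by a valid table is competitive -/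

section Soundness

variable {m n R g k : ℕ} {T : List Entry} {A : Fin m → ℕ} {O : Set (Fin m → ℕ)} {x : ℕ}
  {e : Entry} {s : State}

/-- The state `s` describes the loads `A` of the online schedule and the set `O` of load vectors of
offline schedules. The balance `w j` is the difference between the small jobs that the offline
schedule has on machine `j` and the chunks that stand for them. -/
structure Tracks (n : ℕ) (T : List Entry) (A : Fin m → ℕ) (O : Set (Fin m → ℕ)) (s : State) :
    Prop where
  mem : s.2.2.2 ∈ T
  pos : 0 < s.1
  machine : s.2.2.1 < m
  load_le : ∀ i : Fin m,
    A i + (if (i : ℕ) = s.2.2.1 then s.2.1 else 0) ≤ s.1 * coord s.2.2.2.1 i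
  le_load : ∀ o ∈ O, ∃ q ∈ s.2.2.2.2, ∃ w : Fin m → ℤ, -(s.2.1 : ℤ) ≤ ∑ j, w j ∧
    ∀ j, -((n : ℤ) * n * s.1) ≤ w j ∧
      (n : ℤ) * s.1 * coord q j ≤ (n + 1) * (o j - w j) + n * (n * n + n + 1) * s.1

theorem pickJob_spec {p : ℕ} (hT : Valid m R g k T) (he : e ∈ T) (hs : Small m R e)
    (hp : 0 < p) (hpR : p ≤ R) :
    (pickJob m T e p).1 < m ∧ (pickJob m T e p).2 ∈ T ∧
      JobStep m e p (pickJob m T e p).1 (pickJob m T e p).2 := by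
  obtain ⟨i, hi, e', he', h⟩ := (hT.2 e he).2.2.2 hs (p - 1) (by omega)
  rw [Nat.sub_add_cancel hp] at h
  have := pick_spec (L := (List.range m).flatMap fun i => T.map (Prod.mk i))
    (P := fun q => JobStep m e p q.1 q.2) ⟨(i, e'), by simp [hi, he'], h⟩
  obtain ⟨h1, h2⟩ := this
  obtain ⟨j, hj, h3⟩ := List.mem_flatMap.1 h1
  obtain ⟨e'', he'', h4⟩ := List.mem_map.1 h3
  change (pickJob m T e p).1 < m ∧ _
  have h5 : pickJob m T e p = (j, e'') := h4.symm
  refine ⟨?_, ?_, h2⟩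
  · rw [h5]; exact List.mem_range.1 hj
  · rw [h5]; exact he''

/-- The open chunk is abandoned and all balances restart at 0. Dropping a balance costs `(n + 1) * n
^ 2 * u` and rounding costs `n * u`; added to the old error `n * (n ^ 2 + n + 1) * u` this is
exactly the error allowed for `2 * u`, so errors do not accumulate. -/
theorem Tracks.doubleUnit (hT : Valid m R g k T) (h : Tracks n T A O s) :
    Tracks n T A O (doubleUnit m T s) := by
  obtain ⟨u, v, c, e⟩ := s
  obtain ⟨h1, h2⟩ := pick_spec (L := T) (P := HalfStep m e) (hT.2 e h.mem).2.2.1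
  have hu : 0 < u := h.pos
  refine ⟨h1, Nat.mul_pos two_pos hu, Nat.zero_lt_of_lt h.machine, fun i => ?_, fun o ho => ?_⟩
  · have h3 := h.load_le i
    have h4 := h2.1 i i.2
    change A i + (if _ then 0 else 0) ≤ 2 * u * coord (pick T (HalfStep m e)).1 i
    dsimp only at h3
    rw [ite_self, add_zero]
    calc A i ≤ u * coord e.1 i := le_of_add_le_left h3
      _ ≤ u * (2 * coord (pick T (HalfStep m e)).1 i) := Nat.mul_le_mul_left _ h4
      _ = _ := by ring
  · obtain ⟨q, hq, w, -, hw⟩ := h.le_load o ho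
    obtain ⟨q', hq', h5⟩ := h2.2 q hq
    refine ⟨q', hq', 0, by simp [OnlineList.doubleUnit], fun j => ?_⟩
    obtain ⟨h6, h7⟩ := hw j
    have h8 : (2 : ℤ) * coord q' j ≤ coord q j + 1 := by exact_mod_cast h5 j j.2
    change -((n : ℤ) * n * (2 * u : ℕ)) ≤ 0 ∧ (n : ℤ) * (2 * u : ℕ) * coord q' j ≤
      (n + 1) * (o j - 0) + n * (n * n + n + 1) * (2 * u : ℕ)
    dsimp only at h6 h7
    push_cast
    refine ⟨neg_nonpos.2 (by positivity), ?_⟩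
    have h9 : (n : ℤ) * u * (2 * coord q' j) ≤ n * u * (coord q j + 1) :=
      mul_le_mul_of_nonneg_left h8 (by positivity)
    have h10 : ((n : ℤ) + 1) * (-w j) ≤ (n + 1) * (n * n * u) :=
      mul_le_mul_of_nonneg_left (by linarith) (by positivity)
    linarith

/-- A lower bound on the optimal makespan before a job of size `x` is placed. -/
def Large (Q : ℕ) (O : Set (Fin m → ℕ)) (x u : ℕ) : Prop :=
  ∀ o ∈ O, (∃ j, Q * u ≤ o j) ∨ Q * u ≤ x

/-- Doubling happens only when forced: either each recorded offline vector has a coordinate above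
`R`, so each true one has a large load, or the job exceeds `R` units. `R` is chosen so that both
give `2 * Q * u`. -/
theorem Tracks.large_doubleUnit {Q : ℕ} (h : Tracks n T A O s) (hn : 0 < n)
    (hR : 2 * (2 * Q + n * n) + (n * n + n + 1) ≤ R)
    (hs : ¬(Small m R s.2.2.2 ∧ x ≤ R * s.1)) : Large Q O x (2 * s.1) := by
  obtain ⟨u, v, c, e⟩ := s
  have hu : 0 < u := h.pos
  intro o ho
  by_cases hx : x ≤ R * u
  · left
    obtain ⟨q, hq, w, -, hw⟩ := h.le_load o ho
    have : ∃ j < m, R < coord q j := by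
      by_contra! hcon
      exact hs ⟨⟨q, hq, hcon⟩, hx⟩
    obtain ⟨j, hj, hlt⟩ := this
    refine ⟨⟨j, hj⟩, ?_⟩
    obtain ⟨h1, h2⟩ := hw ⟨j, hj⟩
    dsimp only at h1 h2
    by_contra! hcon
    have hc : (o ⟨j, hj⟩ : ℤ) < Q * (2 * u) := by exact_mod_cast hcon
    have hlt' : (R : ℤ) ≤ coord q j := by exact_mod_cast hlt.le
    have hR' : 2 * (2 * (Q : ℤ) + n * n) + (n * n + n + 1) ≤ R := by exact_mod_cast hR
    have hn' : (1 : ℤ) ≤ n := by exact_mod_cast hn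
    have h3 : (n : ℤ) * u * (2 * (2 * (Q : ℤ) + n * n) + (n * n + n + 1)) ≤ n * u * coord q j :=
      mul_le_mul_of_nonneg_left (hR'.trans hlt') (by positivity)
    have h4 : ((n : ℤ) + 1) * (o ⟨j, hj⟩ - w ⟨j, hj⟩) < (n + 1) * (Q * (2 * u) + n * n * u) :=
      mul_lt_mul_of_pos_left (by linarith) (by positivity)
    -- `n + 1 ≤ 2 * n` explains the outer factor 2 in the bound on `R`.
    have h5 : ((n : ℤ) + 1) * (u * (2 * Q + n * n)) ≤ 2 * n * (u * (2 * Q + n * n)) :=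
      mul_le_mul_of_nonneg_right (by linarith) (by positivity)
    linarith
  · right
    have h1 : 2 * Q * u ≤ R * u := Nat.mul_le_mul_right _ (by nlinarith)
    change Q * (2 * u) ≤ x
    linarith

theorem adjust_iterate {Q t : ℕ} (hT : Valid m R g k T) (h : Tracks n T A O s) (hn : 0 < n)
    (hR : 2 * (2 * Q + n * n) + (n * n + n + 1) ≤ R) (hQ : Large Q O x s.1) :
    Tracks n T A O ((adjust m R T x)^[t] s) ∧ Large Q O x ((adjust m R T x)^[t] s).1 ∧
      ((Small m R ((adjust m R T x)^[t] s).2.2.2 ∧ x ≤ R * ((adjust m R T x)^[t] s).1) ∨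
        (2 ^ t ≤ ((adjust m R T x)^[t] s).1 ∧
          (0 < t → Small m R ((adjust m R T x)^[t] s).2.2.2))) := by
  induction t with
  | zero => exact ⟨h, hQ, Or.inr ⟨h.pos, fun h => absurd h (lt_irrefl 0)⟩⟩
  | succ t ih =>
    rw [Function.iterate_succ_apply']
    obtain ⟨h1, h2, h3⟩ := ih
    set s' := (adjust m R T x)^[t] s
    by_cases hs : Small m R s'.2.2.2 ∧ x ≤ R * s'.1
    · have : adjust m R T x s' = s' := if_pos hs
      rw [this]
      exact ⟨h1, h2, Or.inl hs⟩
    · have : adjust m R T x s' = doubleUnit m T s' := if_neg hs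
      rw [this]
      refine ⟨h1.doubleUnit hT, h1.large_doubleUnit hn hR hs, Or.inr ⟨?_, fun _ => ?_⟩⟩
      · rw [pow_succ']
        exact Nat.mul_le_mul_left _ (h3.resolve_left hs).1
      -- Table states fit in `2 * R`, so one doubling already brings them within `R`; further
      -- doublings serve only the job size.
      · obtain ⟨o, ho, hl⟩ := (hT.2 _ h1.mem).2.1
        obtain ⟨-, h5⟩ := pick_spec (L := T) (P := HalfStep m s'.2.2.2) (hT.2 _ h1.mem).2.2.1
        obtain ⟨o', ho', h6⟩ := h5.2 o ho
        refine ⟨o', ho', fun j hj => ?_⟩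
        have h7 := h6 j hj
        have h8 := hl j hj
        omega

/-- `x` iterations suffice since `x ≤ 2 ^ x`; a fixed iteration count avoids an unbounded loop. -/
theorem Tracks.prepare {Q : ℕ} (hT : Valid m R g k T) (h : Tracks n T A O s) (hn : 0 < n)
    (hR : 2 * (2 * Q + n * n) + (n * n + n + 1) ≤ R) (hQ : Large Q O x s.1) (hx : 0 < x) :
    Tracks n T A O (prepare m R T x s) ∧ Large Q O x (prepare m R T x s).1 ∧
      Small m R (prepare m R T x s).2.2.2 ∧ x ≤ R * (prepare m R T x s).1 := by
  obtain ⟨h1, h2, h3⟩ := adjust_iterate (t := x) hT h hn hR hQ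
  refine ⟨h1, h2, ?_⟩
  rcases h3 with h3 | ⟨h3, h4⟩
  · exact h3
  · refine ⟨h4 hx, ?_⟩
    calc x ≤ 2 ^ x := Nat.lt_two_pow_self.le
      _ ≤ 1 * (OnlineList.prepare m R T x s).1 := by rw [one_mul]; exact h3
      _ ≤ _ := Nat.mul_le_mul_right _ (by omega)

/-- The vector `a` after adding `x` at `i`. -/
def addAt (a : Fin m → ℕ) (x i : ℕ) : Fin m → ℕ := fun j => a j + if (j : ℕ) = i then x else 0

/-- A large job has `n * u ≤ x`, so rounding costs a factor `1 + 1 / n`. A chunk has `n ^ 2 + n`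
units and is closed only when less than `n` units are free, so it holds over `n ^ 2` units of small
jobs: again a factor `1 + 1 / n`. -/
theorem Tracks.place (hT : Valid m R g k T) (h : Tracks n T A O s) (hn : 0 < n)
    (hB : n * n + n ≤ R) (hs : Small m R s.2.2.2) (hxR : x ≤ R * s.1) (hx : 0 < x) :
    (place m n T x s).1.1 = s.1 ∧ (place m n T x s).2 < m ∧
      Tracks n T (addAt A x (place m n T x s).2) {o' | ∃ o ∈ O, ∃ i : Fin m, o' = addAt o x i}
        (place m n T x s).1 := by
  obtain ⟨u, v, c, e⟩ := s
  have hu : 0 < u := h.pos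
  have hm : 0 < m := Nat.zero_lt_of_lt h.machine
  have hload := h.load_le
  have hopt := h.le_load
  dsimp only at hs hxR hload hopt
  unfold OnlineList.place
  dsimp only
  split_ifs with hc hv
  · have hp : (x + u - 1) / u = x ⌈/⌉ u := (Nat.ceilDiv_eq_add_pred_div _ _).symm
    rw [hp]
    have h1 : x ≤ u * (x ⌈/⌉ u) := (ceilDiv_le_iff_le_mul hu).1 le_rfl
    have h2 : x ⌈/⌉ u ≤ R := (ceilDiv_le_iff_le_mul hu).2 (by rwa [mul_comm])
    have h0 : 0 < x ⌈/⌉ u := by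
      by_contra! hcon
      have : x ⌈/⌉ u = 0 := by omega
      rw [this] at h1; omega
    have h3 : u * (x ⌈/⌉ u) ≤ x + u := by
      rw [← hp]
      exact (Nat.mul_div_le _ _).trans (by omega)
    obtain ⟨hi, he, hj⟩ := pickJob_spec hT h.mem hs h0 h2
    refine ⟨rfl, hi, he, hu, h.machine, fun i => ?_, ?_⟩
    · have h4 := hload i
      have h5 := Nat.mul_le_mul_left u (hj.1 i i.2)
      dsimp only at h5
      unfold addAt
      rw [mul_add, mul_ite, mul_zero] at h5
      dsimp only
      split_ifs at h4 h5 ⊢ <;> omega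
    · rintro _ ⟨o, ho, l, rfl⟩
      obtain ⟨q, hq, w, hw, hwj⟩ := hopt o ho
      obtain ⟨q', hq', h4⟩ := hj.2 q hq l l.2
      refine ⟨q', hq', w, hw, fun j => ⟨(hwj j).1, ?_⟩⟩
      have h5 := (hwj j).2
      have h6 : (coord q' j : ℤ) ≤ coord q j + if (j : ℕ) = l then ((x ⌈/⌉ u : ℕ) : ℤ) else 0 := by
        exact_mod_cast h4 j j.2
      have h7 : (n : ℤ) * u * coord q' j ≤
          n * u * (coord q j + if (j : ℕ) = l then ((x ⌈/⌉ u : ℕ) : ℤ) else 0) :=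
        mul_le_mul_of_nonneg_left h6 (by positivity)
      have h8 : (n : ℤ) * (u * (x ⌈/⌉ u : ℕ)) ≤ n * (x + u) :=
        mul_le_mul_of_nonneg_left (by exact_mod_cast h3) (by positivity)
      have h9 : (n : ℤ) * u ≤ x := by exact_mod_cast hc
      unfold addAt
      dsimp only
      split_ifs at h7 ⊢ <;> push_cast <;> linarith
  · refine ⟨rfl, h.machine, h.mem, hu, h.machine, fun i => ?_, ?_⟩
    · have h4 := hload i
      unfold addAt
      dsimp only
      split_ifs at h4 ⊢ <;> omega
    · rintro _ ⟨o, ho, l, rfl⟩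
      obtain ⟨q, hq, w, hw, hwj⟩ := hopt o ho
      refine ⟨q, hq, fun j => w j + if j = l then (x : ℤ) else 0, ?_, fun j => ?_⟩
      · rw [Finset.sum_add_distrib, Finset.sum_ite_eq' Finset.univ l, if_pos (Finset.mem_univ l)]
        dsimp only
        push_cast [hv]
        linarith
      · obtain ⟨h5, h6⟩ := hwj j
        unfold addAt
        simp only [Fin.ext_iff]
        split_ifs <;> push_cast <;> constructor <;> linarith
  · have hnn : 0 < n * n + n := by positivity
    obtain ⟨hi, he, hj⟩ := pickJob_spec hT h.mem hs hnn hB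
    have hxu : x < n * u := not_le.1 hc
    have hxB : x ≤ (n * n + n) * u := by nlinarith
    refine ⟨rfl, hi, he, hu, hi, fun i => ?_, ?_⟩
    · have h4 := hload i
      have h5 := Nat.mul_le_mul_left u (hj.1 i i.2)
      dsimp only at h5
      unfold addAt
      rw [mul_add, mul_ite, mul_zero, mul_comm u (n * n + n)] at h5
      dsimp only
      split_ifs at h4 h5 ⊢ <;> omega
    · rintro _ ⟨o, ho, l, rfl⟩
      obtain ⟨q, hq, w, hw, hwj⟩ := hopt o ho
      have hvx : (v : ℤ) < x := by exact_mod_cast not_le.1 hv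
      have hxu' : (x : ℤ) < n * u := by exact_mod_cast hxu
      have hsum : ∑ j, (w j + if j = l then (x : ℤ) else 0) = ∑ j, w j + x := by
        rw [Finset.sum_add_distrib, Finset.sum_ite_eq' Finset.univ l, if_pos (Finset.mem_univ l)]
      -- The balances sum to at least `x - v > 0`, so some machine has nonnegative balance. The
      -- offline side puts the new chunk there, and that balance stays at least `-n ^ 2 * u`.
      obtain ⟨t, -, ht⟩ : ∃ t ∈ Finset.univ, 0 ≤ w t + if t = l then (x : ℤ) else 0 := by
        have : Nonempty (Fin m) := ⟨l⟩
        refine Finset.exists_le_of_sum_le Finset.univ_nonempty ?_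
        rw [hsum, Finset.sum_const_zero]
        linarith
      obtain ⟨q', hq', h4⟩ := hj.2 q hq t t.2
      refine ⟨q', hq', fun j => (w j + if j = l then (x : ℤ) else 0) -
        if j = t then (n : ℤ) * n * u else 0, ?_, fun j => ?_⟩
      · rw [Finset.sum_sub_distrib, hsum, Finset.sum_ite_eq' Finset.univ t,
          if_pos (Finset.mem_univ t)]
        dsimp only
        push_cast [hxB]
        linarith
      · obtain ⟨h5, h6⟩ := hwj j
        have h7 : (coord q' j : ℤ) ≤ coord q j + if (j : ℕ) = t then ((n : ℤ) * n + n) else 0 := by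
          exact_mod_cast h4 j j.2
        have h8 := mul_le_mul_of_nonneg_left h7 (by positivity : (0 : ℤ) ≤ n * u)
        have hnu : (0 : ℤ) ≤ (n : ℤ) * n * u := by positivity
        have hx0 : (0 : ℤ) ≤ x := by positivity
        unfold addAt
        simp only [← Fin.ext_iff] at h8 ⊢
        constructor
        · by_cases hjt : j = t
          · subst hjt
            rw [if_pos rfl]
            linarith
          · rw [if_neg hjt]
            split_ifs <;> linarith
        · split_ifs at h8 ⊢ <;> push_cast <;> linarith

end Soundness

/-! ### Competitive ratio of the table algorithm -/

section Competitive

variable {m n Q R g k : ℕ} {T : List Entry}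

/-- The load vectors, scaled by `Q`, of all schedules of the jobs `I`. -/
def offline (m Q : ℕ) (I : List ℕ) : Set (Fin m → ℕ) :=
  {o | ∃ S : Schedule m, S.map Prod.fst = I ∧ o = fun i => Q * load S i}

theorem scaled_load_concat (S : Schedule m) (p : ℕ) (i : Fin m) :
    (fun j => Q * load (S ++ [(p, i)]) j) = addAt (fun j => Q * load S j) (Q * p) i := by
  funext j
  simp only [load_concat, addAt, Fin.ext_iff, mul_add, mul_ite, mul_zero]

theorem offline_concat {I : List ℕ} {p : ℕ} :
    offline m Q (I ++ [p]) ⊆ {o' | ∃ o ∈ offline m Q I, ∃ i : Fin m, o' = addAt o (Q * p) i} := by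
  rintro _ ⟨S, hS, rfl⟩
  obtain ⟨S', i, hS', rfl⟩ := exists_eq_concat hS
  exact ⟨_, ⟨S', hS', rfl⟩, i, scaled_load_concat S' p i⟩

/-- The online algorithm given by the table `T`. -/
noncomputable def tableAlgorithm (hm : 0 < m) (n Q R : ℕ) (T : List Entry) : OnlineAlgorithm m :=
  fun C => ⟨chosenMachine m n Q R T (C.1.map Prod.fst) C.2, Nat.mod_lt _ hm⟩

theorem tracks_stateAfter (hm : 0 < m) (hn : 0 < n) (hQ : 0 < Q)
    (hR : 2 * (2 * Q + n * n) + (n * n + n + 1) ≤ R) (hT : Valid m R g k T) {I : List ℕ}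
    (hI : IsInstance I) :
    Tracks n T (fun i => Q * load (run (tableAlgorithm hm n Q R T) I) i) (offline m Q I)
        (stateAfter m n Q R T I) ∧
      (I ≠ [] → ∀ o ∈ offline m Q I, ∃ j, Q * (stateAfter m n Q R T I).1 ≤ o j) := by
  induction I using List.reverseRecOn with
  | nil =>
    refine ⟨?_, fun h => absurd rfl h⟩
    obtain ⟨h1, o, ho, h2⟩ := pick_spec (L := T) (P := Small m 0) hT.1
    refine ⟨h1, one_pos, hm, fun i => ?_, ?_⟩
    · change Q * 0 + (if _ then 0 else 0) ≤ _
      rw [ite_self]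
      exact Nat.zero_le _
    · rintro _ ⟨S, hS, rfl⟩
      obtain rfl := List.map_eq_nil_iff.1 hS
      refine ⟨o, ho, 0, by simp [stateAfter], fun j => ?_⟩
      have h3 : coord o j = 0 := Nat.le_zero.1 (h2 j j.2)
      have h4 : (fun i : Fin m => Q * load [] i) j = 0 := rfl
      rw [h3, h4]
      simp only [Pi.zero_apply, Nat.cast_zero, mul_zero, sub_zero, zero_add]
      exact ⟨neg_nonpos.2 (by positivity), by positivity⟩
  | append_singleton I p ih =>
    have hI' : IsInstance I := fun q hq => hI q (List.mem_append_left _ hq)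
    have hp : 1 ≤ p := hI p (by simp)
    obtain ⟨h1, h2⟩ := ih hI'
    set f := tableAlgorithm hm n Q R T with hf
    set s := stateAfter m n Q R T I with hs
    have hx : 0 < Q * p := Nat.mul_pos hQ hp
    have hlarge : Large Q (offline m Q I) (Q * p) s.1 := by
      intro o ho
      by_cases hnil : I = []
      -- For the first job the unit is 1 and the scaled job is itself at least `Q`.
      · right
        have : s.1 = 1 := by rw [hs, hnil]; rfl
        rw [this]
        exact Nat.mul_le_mul_left _ hp
      · exact Or.inl (h2 hnil o ho)
    obtain ⟨h3, h4, h5, h6⟩ := h1.prepare hT hn hR hlarge hx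
    obtain ⟨h7, h8, h9⟩ := h3.place hT hn (by omega) h5 h6 hx
    have hstate : stateAfter m n Q R T (I ++ [p]) =
        (place m n T (Q * p) (prepare m R T (Q * p) s)).1 := by
      simp [stateAfter, hs, process]
    have hmach : ((f (run f I, p) : Fin m) : ℕ) =
        (place m n T (Q * p) (prepare m R T (Q * p) s)).2 := by
      have : ((f (run f I, p) : Fin m) : ℕ) =
        chosenMachine m n Q R T ((run f I).map Prod.fst) p := rfl
      rw [this, run_map_fst]
      -- The reduction modulo `m` only makes the choice total; here the machine is already below
      -- `m`.
      exact Nat.mod_eq_of_lt h8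
    rw [hstate, run_concat, scaled_load_concat, hmach]
    refine ⟨⟨h9.mem, h9.pos, h9.machine, h9.load_le, fun o ho =>
      h9.le_load o (offline_concat ho)⟩, fun _ o ho => ?_⟩
    obtain ⟨o', ho', l, rfl⟩ := offline_concat ho
    rw [h7]
    rcases h4 o' ho' with ⟨j, hj⟩ | hj
    · exact ⟨j, hj.trans (Nat.le_add_right _ _)⟩
    · refine ⟨l, hj.trans ?_⟩
      simp [addAt]

theorem isCompetitive_tableAlgorithm (hm : 0 < m) (hn : 0 < n) (hg : 0 < g) (hQ : 0 < Q)
    (hR : 2 * (2 * Q + n * n) + (n * n + n + 1) ≤ R)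
    (hk : k * ((n + 1) * (n * n) + n * (n * n + n + 1)) + n * g ≤ Q) (hT : Valid m R g k T) :
    IsCompetitive (tableAlgorithm hm n Q R T) (((k * (n + 1) + 1 : ℕ) : ℝ) / (n * g : ℕ)) := by
  intro I hI
  rw [div_mul_eq_mul_div, le_div_iff₀ (by exact_mod_cast Nat.mul_pos hn hg), mul_comm]
  norm_cast
  have : Nonempty (Fin m) := ⟨⟨0, hm⟩⟩
  by_cases hnil : I = []
  · subst hnil
    have : makespan (run (tableAlgorithm hm n Q R T) []) = 0 := by
      simp [makespan, run, load]
    rw [this]; simp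
  obtain ⟨h1, h2⟩ := tracks_stateAfter hm hn hQ hR hT hI
  obtain ⟨S, hS, hopt⟩ := exists_makespan_eq_opt hm I
  obtain ⟨i, -, hi⟩ := Finset.exists_mem_eq_sup Finset.univ Finset.univ_nonempty
    (load (run (tableAlgorithm hm n Q R T) I))
  have hmk : makespan (run (tableAlgorithm hm n Q R T) I) =
    load (run (tableAlgorithm hm n Q R T) I) i := hi
  rw [hmk]
  have hl := h1.load_le i
  obtain ⟨q, hq, w, -, hw⟩ := h1.le_load _ ⟨S, hS, rfl⟩
  obtain ⟨j, hj, hsound⟩ := (hT.2 _ h1.mem).1 q hq i i.2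
  obtain ⟨j', hj'⟩ := h2 hnil _ ⟨S, hS, rfl⟩
  obtain ⟨h3, h4⟩ := hw ⟨j, hj⟩
  generalize (stateAfter m n Q R T I) = s at *
  generalize load (run (tableAlgorithm hm n Q R T) I) i = a at *
  have h5 : load S ⟨j, hj⟩ ≤ opt m I := hopt ▸ load_le_makespan S _
  have h6 : load S j' ≤ opt m I := hopt ▸ load_le_makespan S _
  generalize opt m I = z at *
  obtain ⟨u, v, c, e⟩ := s
  dsimp only at *
  have e1 : (n : ℤ) * u * coord q j ≤ (n + 1) * (Q * z + n * n * u) + n * (n * n + n + 1) * u := by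
    have h7 : (load S ⟨j, hj⟩ : ℤ) ≤ z := by exact_mod_cast h5
    have h8 : ((Q * load S ⟨j, hj⟩ : ℕ) : ℤ) ≤ Q * z := by
      push_cast
      exact mul_le_mul_of_nonneg_left h7 (by positivity)
    have h9 : ((n : ℤ) + 1) * (((Q * load S ⟨j, hj⟩ : ℕ) : ℤ) - w ⟨j, hj⟩) ≤
        (n + 1) * (Q * z + n * n * u) := mul_le_mul_of_nonneg_left (by linarith) (by positivity)
    linarith
  have e2 : n * u * coord q j ≤ (n + 1) * (Q * z + n * n * u) + n * (n * n + n + 1) * u := by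
    exact_mod_cast e1
  have e3 : u ≤ z := Nat.le_of_mul_le_mul_left (hj'.trans (Nat.mul_le_mul_left Q h6)) hQ
  have e4 : Q * a ≤ u * coord e.1 i := le_of_add_le_left hl
  refine le_of_mul_le_mul_left ?_ hQ
  calc Q * (n * g * a) = n * g * (Q * a) := by ring
    _ ≤ n * g * (u * coord e.1 i) := Nat.mul_le_mul_left _ e4
    _ = n * u * (g * coord e.1 i) := by ring
    _ ≤ n * u * (k * coord q j + g) := Nat.mul_le_mul_left _ hsound
    _ = k * (n * u * coord q j) + n * g * u := by ring
    _ ≤ k * ((n + 1) * (Q * z + n * n * u) + n * (n * n + n + 1) * u) + n * g * u :=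
        Nat.add_le_add_right (Nat.mul_le_mul_left _ e2) _
    _ = Q * (k * (n + 1) * z) +
          (k * ((n + 1) * (n * n) + n * (n * n + n + 1)) + n * g) * u := by ring
    -- All additive errors together are at most `Q * u`, and `u ≤ z`: this is the `+ 1` in the
    -- ratio.
    _ ≤ Q * (k * (n + 1) * z) + Q * z :=
        Nat.add_le_add_left (Nat.mul_le_mul hk e3) _
    _ = Q * ((k * (n + 1) + 1) * z) := by ring

end Competitive

/-! ### The approximation scheme -/

/-- The scaling factor of the job sizes. -/
def scale (m n : ℕ) : ℕ :=
  n * (m + 2) * ((n + 1) * (n * n) + n * (n * n + n + 1)) + n * n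

/-- The largest size of an abstract job. -/
def jobBound (m n : ℕ) : ℕ := 2 * (2 * scale m n + n * n) + (n * n + n + 1)

/-- All candidates for a valid table. -/
def tables (m n : ℕ) : List (List Entry) := subs (entries (m * (2 * jobBound m n)) m)

/-- There is a valid table for the ratio `k / n`. -/
def HasTable (m n k : ℕ) : Prop := ∃ T ∈ tables m n, Valid m (jobBound m n) n k T

/-- An index `i` such that there is a valid table for the ratio `(n + i + 1) / n`, but none for the
ratio `(n + i) / n` unless `i = 0`. -/
noncomputable def ratioIndex (m n : ℕ) : ℕ :=
  pick (List.range (n * m + 1)) fun i => HasTable m n (n + i + 1) ∧ (i = 0 ∨ ¬HasTable m n (n + i))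

/-- A valid table for the ratio `(n + ratioIndex m n + 1) / n`. -/
noncomputable def bestTable (m n : ℕ) : List Entry :=
  pick (tables m n) (Valid m (jobBound m n) n (n + ratioIndex m n + 1))

/-! ### Primitive recursiveness of the search for the ratio and the table -/

section Computability

variable {α : Type*} [Primcodable α] {m n k : α → ℕ}

theorem primrec_scale (hm : Primrec m) (hn : Primrec n) :
    Primrec fun a => scale (m a) (n a) := by
  have hnn := Primrec.nat_mul.comp hn hn
  refine Primrec.nat_add.comp (Primrec.nat_mul.comp (Primrec.nat_mul.comp hn
    (Primrec.nat_add.comp hm (Primrec.const 2))) (Primrec.nat_add.comp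
      (Primrec.nat_mul.comp (Primrec.succ.comp hn) hnn) (Primrec.nat_mul.comp hn
        (Primrec.succ.comp (Primrec.nat_add.comp hnn hn))))) hnn

theorem primrec_jobBound (hm : Primrec m) (hn : Primrec n) :
    Primrec fun a => jobBound (m a) (n a) := by
  have hnn := Primrec.nat_mul.comp hn hn
  exact Primrec.nat_add.comp (Primrec.nat_double.comp (Primrec.nat_add.comp
    (Primrec.nat_double.comp (primrec_scale hm hn)) hnn))
      (Primrec.succ.comp (Primrec.nat_add.comp hnn hn))

theorem primrec_tables (hm : Primrec m) (hn : Primrec n) :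
    Primrec fun a => tables (m a) (n a) :=
  primrec_subs (primrec_entries (Primrec.nat_mul.comp hm
    (Primrec.nat_double.comp (primrec_jobBound hm hn))) hm)

theorem primrecPred_hasTable (hm : Primrec m) (hn : Primrec n) (hk : Primrec k) :
    PrimrecPred fun a => HasTable (m a) (n a) (k a) :=
  PrimrecPred.exists_mem (primrec_tables hm hn) (primrecPred_valid (hm.comp .fst)
    ((primrec_jobBound hm hn).comp .fst) (hn.comp .fst) (hk.comp .fst) .snd)

theorem primrec_ratioIndex (hm : Primrec m) (hn : Primrec n) :
    Primrec fun a => ratioIndex (m a) (n a) := by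
  have h : Primrec fun x : α × ℕ => n x.1 + x.2 := Primrec.nat_add.comp (hn.comp .fst) .snd
  exact primrec_pick (Primrec.list_range.comp (Primrec.succ.comp (Primrec.nat_mul.comp hn hm)))
    (PrimrecPred.and (primrecPred_hasTable (hm.comp .fst) (hn.comp .fst) (Primrec.succ.comp h))
      (PrimrecPred.or (Primrec.eq.comp .snd (Primrec.const 0))
        (primrecPred_hasTable (hm.comp .fst) (hn.comp .fst) h).not))

theorem primrec_bestTable (hm : Primrec m) (hn : Primrec n) :
    Primrec fun a => bestTable (m a) (n a) :=
  primrec_pick (primrec_tables hm hn) (primrecPred_valid (hm.comp .fst)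
    ((primrec_jobBound hm hn).comp .fst) (hn.comp .fst)
    ((Primrec.succ.comp (Primrec.nat_add.comp hn (primrec_ratioIndex hm hn))).comp .fst) .snd)

end Computability

theorem ratioIndex_spec {m n : ℕ} (hm : 0 < m) (hn : 0 < n) :
    ratioIndex m n ≤ n * m ∧ HasTable m n (n + ratioIndex m n + 1) ∧
      (ratioIndex m n = 0 ∨ ¬HasTable m n (n + ratioIndex m n)) := by
  classical
  have h : HasTable m n (n + n * m + 1) := by
    refine exists_valid hm hn (IsCompetitive.mono (isCompetitive_machines hm
      fun _ => ⟨0, hm⟩) ?_) _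
    rw [le_div_iff₀ (by exact_mod_cast hn)]
    norm_cast
    linarith
  have hex : ∃ i, HasTable m n (n + i + 1) := ⟨_, h⟩
  have h1 := pick_spec (L := List.range (n * m + 1))
    (P := fun i => HasTable m n (n + i + 1) ∧ (i = 0 ∨ ¬HasTable m n (n + i)))
    -- The least index with a table qualifies; monotonicity of `HasTable` in `k` is not needed.
    ⟨Nat.find hex, List.mem_range.2 (Nat.lt_succ_of_le (Nat.find_min' hex h)), Nat.find_spec hex, by
      rcases Nat.eq_zero_or_pos (Nat.find hex) with h0 | h0
      · exact Or.inl h0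
      · have h2 := Nat.find_min hex (Nat.sub_lt h0 one_pos)
        rw [add_assoc, show Nat.find hex - 1 + 1 = Nat.find hex by omega] at h2
        exact Or.inr h2⟩
  exact ⟨Nat.le_of_lt_succ (List.mem_range.1 h1.1), h1.2⟩

/-- A smaller optimal ratio would give an algorithm, hence a table, at `(n + ratioIndex m n) / n`.
-/
theorem le_optimalRatio_of_ratioIndex {m n : ℕ} (hm : 0 < m) (hn : 0 < n) :
    ((n + ratioIndex m n : ℕ) : ℝ) / n ≤ optimalRatio m := by
  have hn' : (0 : ℝ) < n := by exact_mod_cast hn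
  rcases (ratioIndex_spec hm hn).2.2 with h | h
  · rw [h, add_zero, div_self hn'.ne']
    exact one_le_optimalRatio hm
  · by_contra! hlt
    obtain ⟨f, hf⟩ := exists_isCompetitive_of_optimalRatio_lt hm hlt
    exact h (exists_valid hm hn hf _)

theorem competitiveRatio_bestTable {m b : ℕ} (hm : 0 < m) (hb : 0 < b) :
    competitiveRatio (tableAlgorithm hm (4 * b) (scale m (4 * b)) (jobBound m (4 * b))
      (bestTable m (4 * b))) ≤
        (1 + 1 / (b : ℝ)) * (((4 * b + ratioIndex m (4 * b) : ℕ) : ℝ) / (4 * b : ℕ)) := by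
  have hn : 0 < 4 * b := by omega
  have hnb : ((4 * b : ℕ) : ℝ) = 4 * b := by push_cast; rfl
  have hb' : (0 : ℝ) < b := by exact_mod_cast hb
  obtain ⟨h1, h2, -⟩ := ratioIndex_spec hm hn
  set n := 4 * b with hnd
  have hT := (pick_spec h2).2
  have hQ : 0 < scale m n := by unfold scale; positivity
  have hk : (n + ratioIndex m n + 1) * ((n + 1) * (n * n) + n * (n * n + n + 1)) + n * n ≤
      scale m n := by
    -- The index is at most `n * m`, so `k ≤ n * (m + 2)`, the factor built into `scale`.
    refine Nat.add_le_add_right (Nat.mul_le_mul_right _ ?_) _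
    rw [mul_add]; omega
  refine (competitiveRatio_le (isCompetitive_tableAlgorithm hm hn hn hQ le_rfl hk hT)).trans ?_
  have hP : (n : ℝ) ≤ (n + ratioIndex m n : ℕ) := by exact_mod_cast Nat.le_add_right _ _
  push_cast at hP ⊢
  generalize (ratioIndex m n : ℝ) = r at *
  rw [hnb] at *
  have hb1 : (1 : ℝ) ≤ b := by exact_mod_cast hb
  rw [div_le_iff₀ (by positivity)]
  have : (1 + 1 / (b : ℝ)) * ((4 * b + r) / (4 * b)) * (4 * b * (4 * b)) =
    4 * (b + 1) * (4 * b + r) := by field_simp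
  rw [this]
  -- With `P = n + r ≥ n` the claim is `(P + 1) * (n + 1) + 1 ≤ (n + 4) * P`, that is `n + 2 ≤ 3 *
  -- P`.
  nlinarith

/-! ### Programs for the table algorithms -/

/-- An element of `Fin m` has the code of its value, so one program reads the schedules for all `m`.
-/
theorem encode_schedule {m : ℕ} (S : Schedule m) :
    Encodable.encode S = Encodable.encode (S.map fun j => (j.1, (j.2 : ℕ))) := by
  induction S with
  | nil => rfl
  | cons j S ih =>
    rw [List.map_cons, Encodable.encode_list_cons, Encodable.encode_list_cons, ih]
    rfl

theorem exists_code_of_computable {α : Type*} [Primcodable α] {f : α → ℕ} (hf : Computable f) :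
    ∃ c : Nat.Partrec.Code, ∀ a, c.eval (Encodable.encode a) = Part.some (f a) := by
  obtain ⟨c, hc⟩ := Nat.Partrec.Code.exists_code.1 hf
  refine ⟨c, fun a => (congrFun hc _).trans ?_⟩
  simp

/-- A single program runs the algorithms of all tables. -/
theorem exists_universal_code : ∃ c : Nat.Partrec.Code,
    ∀ (m n : ℕ) (T : List Entry) (H : List (ℕ × ℕ)) (p : ℕ),
      c.eval (Nat.pair (Encodable.encode (m, n, T)) (Encodable.encode (H, p))) =
        Part.some (chosenMachine m n (scale m n) (jobBound m n) T (H.map Prod.fst) p) := by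
  have hm : Primrec fun x : (ℕ × ℕ × List Entry) × List (ℕ × ℕ) × ℕ => x.1.1 :=
    Primrec.fst.comp .fst
  have h2 : Primrec fun x : (ℕ × ℕ × List Entry) × List (ℕ × ℕ) × ℕ => x.1.2 :=
    Primrec.snd.comp .fst
  have hn := Primrec.fst.comp h2
  have h := (primrec_chosenMachine hm hn (primrec_scale hm hn) (primrec_jobBound hm hn)
    (Primrec.snd.comp h2)
    (Primrec.list_map (Primrec.fst.comp .snd) (Primrec.fst.comp .snd).to₂)
    (Primrec.snd.comp .snd)).to_comp
  obtain ⟨c, hc⟩ := exists_code_of_computable h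
  exact ⟨c, fun m n T H p => hc ((m, n, T), (H, p))⟩

end OnlineList

open OnlineList in
theorem mainTheorem1 :
    ∃ F : ℕ × ℕ × ℕ → Nat.Partrec.Code × ℕ × ℕ, OnlineList.IsApproximationScheme F := by
  obtain ⟨c₀, hc₀⟩ := exists_universal_code
  -- The output program is the universal one with `m`, `n` and the table hard-wired. Only `b`
  -- matters, since `a / b ≥ 1 / b`.
  refine ⟨fun x => (Nat.Partrec.Code.curry c₀ (Encodable.encode
    (x.1, 4 * x.2.2, bestTable x.1 (4 * x.2.2))),
      4 * x.2.2 + ratioIndex x.1 (4 * x.2.2), 4 * x.2.2), ?_, ?_⟩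
  · have hn : Primrec fun x : ℕ × ℕ × ℕ => 4 * x.2.2 :=
      Primrec.nat_mul.comp (Primrec.const 4) (Primrec.snd.comp .snd)
    refine (Primrec.pair (Nat.Partrec.Code.primrec₂_curry.comp (Primrec.const c₀)
      (Primrec.encode.comp (Primrec.pair .fst (Primrec.pair hn (primrec_bestTable .fst hn)))))
      (Primrec.pair (Primrec.nat_add.comp hn (primrec_ratioIndex .fst hn)) hn)).to_comp
  · rintro m a b hm ha hb c p q h
    obtain ⟨rfl, rfl, rfl⟩ := by simpa only [Prod.mk.injEq] using h
    have hn : 0 < 4 * b := by omega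
    have hlow := le_optimalRatio_of_ratioIndex hm hn
    have hup := competitiveRatio_bestTable hm hb
    have hb' : (0 : ℝ) < b := by exact_mod_cast hb
    have hε : 1 + 1 / (b : ℝ) ≤ 1 + (a : ℝ) / b := by
      have : (1 : ℝ) ≤ a := by exact_mod_cast ha
      gcongr
    refine ⟨⟨_, fun C => ?_, hup.trans (mul_le_mul hε hlow (by positivity) (by positivity))⟩,
      hn, hlow, ((optimalRatio_le hm _).trans hup).trans
        (mul_le_mul_of_nonneg_right hε (by positivity))⟩
    obtain ⟨S, x⟩ := C
    have h1 : Encodable.encode ((S, x) : Configuration m) =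
        Encodable.encode (S.map fun j => (j.1, (j.2 : ℕ)), x) := by
      rw [Encodable.encode_prod_val, Encodable.encode_prod_val, encode_schedule]
    rw [Nat.Partrec.Code.eval_curry, h1, hc₀, List.map_map]
    rfl
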